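/- All graphs are finite, simple and undirected. For a graph $G$, a *threshold assignment* is a function $\tau:V(G)\to\{0,1,2,\dots\}$ with $\tau(v)\le \deg_G(v)$ for every vertex $v$; its average is $\overline{\tau}=\frac{1}{|V(G)|}\sum_{v\in V(G)}\tau(v)$. A set $D\subseteq V(G)$ is a *$\tau$-dynamic monopoly* of $G$ if for some integer $k\ge 0$ the set $V(G)$ can be partitioned into (possibly empty) sets $D_0,D_1,\dots,D_k$ such that $D_0=D$ and, for $1\le i\le k$, $D_i$ consists of all vertices $v\notin D_0\cup\dots\cup D_{i-1}$ that have at least $\tau(v)$ neighbours in $D_0\cup\dots\cup D_{i-1}$. Let $dyn_\tau(G)$ be the smallest size of a $\tau$-dynamic monopoly of $G$, and for a real number $t>0$ let $Ldyn_t(G)$ be the maximum of $dyn_\tau(G)$ over all threshold assignments $\tau$ of $G$ with $\overline{\tau}\le t$. **Proposition 3.5.** Let $F$ be a forest and let $t>0$ be a real number. Then there exists a matching $M$ in $F$ such that the threshold assignment $$\tau(w)=\begin{cases}\deg_F(w) & \text{if } w \text{ is saturated by } M \text{ (i.e. is an endpoint of an edge of } M),\\ 0 & \text{otherwise}\end{cases}$$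 satisfies $\overline{\tau}\le t$ and $Ldyn_t(F)=dyn_\tau(F)=|M|$, where $|M|$ is the number of edges of $M$. -/

import Mathlib

open Finset

namespace DynamicMonopoly

variable {V : Type*} [Fintype V] [DecidableEq V]

/-- A vertex set `D` is a `τ`-dynamic monopoly of `G` if for some `k` the vertex set can be
partitioned into (possibly empty) sets `P 0 = D, P 1, …, P k` such that for `1 ≤ i ≤ k` the set
`P i` consists of all vertices `v` outside of `P 0 ∪ … ∪ P (i - 1)` that have at least `τ v`
neighbours in `P 0 ∪ … ∪ P (i - 1)`. -/
def IsDynamo (G : SimpleGraph V) [DecidableRel G.Adj] (τ : V → ℕ) (D : Finset V) : Prop :=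
  ∃ (k : ℕ) (P : ℕ → Finset V), P 0 = D ∧
    (∀ v, ∃! i, i ≤ k ∧ v ∈ P i) ∧
    ∀ i, 1 ≤ i → i ≤ k → ∀ v, v ∈ P i ↔
      (∀ j < i, v ∉ P j) ∧ τ v ≤ #{w ∈ G.neighborFinset v | ∃ j < i, w ∈ P j}

/-- The smallest size of a `τ`-dynamic monopoly of `G`. -/
noncomputable def dyn (G : SimpleGraph V) [DecidableRel G.Adj] (τ : V → ℕ) : ℕ :=
  sInf {n | ∃ D : Finset V, IsDynamo G τ D ∧ #D = n}

/-- The average threshold of `τ`. -/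
noncomputable def average {V : Type*} [Fintype V] (τ : V → ℕ) : ℝ :=
  (∑ v, (τ v : ℝ)) / Fintype.card V

/-- The values `dyn G τ`, where `τ` runs over the threshold assignments of average at most `t`
without self-opinioned vertices, i.e. with `τ v ≤ deg v` for all `v`. -/
def dynValues (G : SimpleGraph V) [DecidableRel G.Adj] (t : ℝ) : Set ℕ :=
  {n | ∃ τ : V → ℕ, (∀ v, τ v ≤ G.degree v) ∧ average τ ≤ t ∧ dyn G τ = n}

/-- The largest value of `dyn G τ` over the threshold assignments of average at most `t`
(a true maximum for `t ≥ 0`, see `isGreatest_ldyn`). -/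
noncomputable def ldyn (G : SimpleGraph V) [DecidableRel G.Adj] (t : ℝ) : ℕ :=
  sSup (dynValues G t)

open Classical in
/-- The (zero,degree)-assignment that is the degree on the vertices saturated by `M`,
and zero elsewhere. -/
noncomputable def matchingAssignment {V : Type*} [Fintype V] (G : SimpleGraph V)
    [DecidableRel G.Adj] (M : G.Subgraph) : V → ℕ :=
  fun w => if w ∈ M.support then G.degree w else 0

theorem isDynamo_univ (G : SimpleGraph V) [DecidableRel G.Adj] (τ : V → ℕ) :
    IsDynamo G τ univ := by
  refine ⟨0, fun _ => univ, rfl, fun v => ⟨0, by simp, fun j hj => by simpa using hj.1⟩, ?_⟩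
  intro i h1 h2
  omega

/-- The minimum in the definition of `dyn` is attained. -/
theorem exists_isDynamo_card_eq_dyn (G : SimpleGraph V) [DecidableRel G.Adj] (τ : V → ℕ) :
    ∃ D : Finset V, IsDynamo G τ D ∧ #D = dyn G τ :=
  Nat.sInf_mem (s := {n | ∃ D : Finset V, IsDynamo G τ D ∧ #D = n})
    ⟨_, univ, isDynamo_univ G τ, rfl⟩

/-- The maximum in the definition of `ldyn` is attained. -/
theorem isGreatest_ldyn (G : SimpleGraph V) [DecidableRel G.Adj] {t : ℝ} (ht : 0 ≤ t) :
    IsGreatest (dynValues G t) (ldyn G t) := by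
  have hb : BddAbove (dynValues G t) := by
    refine ⟨Fintype.card V, ?_⟩
    rintro n ⟨τ, -, -, rfl⟩
    obtain ⟨D, -, hD⟩ := exists_isDynamo_card_eq_dyn G τ
    exact hD ▸ card_le_univ D
  have hne : (dynValues G t).Nonempty :=
    ⟨_, fun _ => 0, fun _ => Nat.zero_le _, by simpa [average] using ht, rfl⟩
  exact ⟨Nat.sSup_mem hne hb, fun n hn => le_csSup hb hn⟩

end DynamicMonopoly

/-!
A dynamic monopoly for thresholds equal to the degree on the vertices saturated by a matching `M`,
and zero elsewhere, contains an endpoint of each edge of `M`; in a bipartite graph the saturated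
vertices of one colour class suffice (`DynamicMonopoly.dyn_matchingAssignment`). So it is enough to
find, for an arbitrary threshold assignment `τ` on a forest, a matching `M` with `dyn τ ≤ |M|` whose
saturated vertices have total degree at most `∑ τ`
(`DynamicMonopoly.exists_isMatching_dyn_le`). Applied to an optimal `τ` it gives the result.

To find `M`, root the forest and go from the leaves to the roots. Let `n v` be the number of children
of `v` that do not await `v`; say that `v` awaits its parent if it has one and `n v + 1 = τ v`. The
set `D` of the vertices that do not await a parent and satisfy `n v < τ v` is a dynamic monopoly:
the vertices not awaiting a parent become active from the leaves up, and then the others from the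
roots down. Since `τ v ≤ deg v`, each `v ∈ D` has a child `f v` that awaits it, and the edges from
`v` to `f v` form the matching.

For the weight, let `b v` be the number of children awaiting `v`. Then `deg v + 1 ≤ τ v + b v` for
`v ∈ D`, and `deg u = τ u + b u` for a vertex `u` awaiting its parent. Summing over the saturated
vertices, the total degree exceeds the total threshold by at most the number of unmatched vertices
that await a saturated parent, and each of these has threshold at least one.
-/

/-! ### Dynamic monopolies and the thresholds of a matching -/

namespace DynamicMonopoly

/-- If every superset of `D` that is closed under the activation rule is everything, then
`D` is a dynamic monopoly. -/
theorem isDynamo_of_forall_closed {V : Type*} [Fintype V] [DecidableEq V] {G : SimpleGraph V}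
    [DecidableRel G.Adj] {τ : V → ℕ} {D : Finset V}
    (h : ∀ S : Finset V, D ⊆ S → (∀ v, τ v ≤ #{w ∈ G.neighborFinset v | w ∈ S} → v ∈ S) →
      S = univ) : IsDynamo G τ D := by
  let step : Finset V → Finset V := fun T =>
    T ∪ univ.filter fun v => τ v ≤ #{w ∈ G.neighborFinset v | w ∈ T}
  have hstep (T : Finset V) (v : V) :
      v ∈ step T ↔ v ∈ T ∨ τ v ≤ #{w ∈ G.neighborFinset v | w ∈ T} := by simp [step]
  let S : ℕ → Finset V := fun n => step^[n] D
  have hS0 : S 0 = D := rfl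
  have hS (n : ℕ) : S (n + 1) = step (S n) := Function.iterate_succ_apply' step n D
  have hmono : Monotone S := monotone_nat_of_le_succ fun n => by
    rw [hS]; exact subset_union_left
  obtain ⟨k, hk⟩ : ∃ k, S k = univ := by
    by_contra! hne
    have hstrict : StrictMono S := strictMono_nat_of_lt_succ fun n => by
      refine lt_of_le_of_ne (hmono n.le_succ) fun heq => hne n (h _ (hmono n.zero_le) fun v hv => ?_)
      rw [heq, hS, hstep]
      exact Or.inr hv
    have h1 := (Finset.card_strictMono.comp hstrict).le_apply (x := Fintype.card V + 1)
    have h2 := card_le_univ (S (Fintype.card V + 1))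
    simp only [Function.comp_apply] at h1
    omega
  let P : ℕ → Finset V := fun i => S i \ (if i = 0 then ∅ else S (i - 1))
  have hP0 : P 0 = D := by simp [P, hS0]
  have hP (i : ℕ) : P (i + 1) = S (i + 1) \ S i := by simp [P]
  have hPS (n : ℕ) (v : V) : (∃ j < n + 1, v ∈ P j) ↔ v ∈ S n := by
    induction n with
    | zero => simp [hP0, hS0]
    | succ n ih =>
      have hle := @hmono n (n + 1) n.le_succ v
      rw [Nat.exists_lt_succ_right, ih, hP, mem_sdiff]
      tauto
  refine ⟨k, P, hP0, fun v => ?_, fun i hi _ v => ?_⟩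
  · obtain ⟨i, hik, hi⟩ := (hPS k v).2 (hk ▸ mem_univ v)
    have hlt : ∀ a b, v ∈ P a → v ∈ P b → ¬ a < b := by
      intro a b ha hb hab
      obtain ⟨b, rfl⟩ : ∃ c, b = c + 1 := ⟨b - 1, by omega⟩
      rw [hP, mem_sdiff] at hb
      exact hb.2 ((hPS b v).1 ⟨a, hab, ha⟩)
    refine ⟨i, ⟨by omega, hi⟩, fun j hj => ?_⟩
    have := hlt i j hi hj.2
    have := hlt j i hj.2 hi
    omega
  · obtain ⟨i, rfl⟩ : ∃ c, i = c + 1 := ⟨i - 1, by omega⟩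
    have h1 : (∀ j < i + 1, v ∉ P j) ↔ v ∉ S i := by
      rw [← hPS]; push Not; rfl
    simp only [hPS, h1, hP, hS, hstep, mem_sdiff]
    tauto

theorem dyn_le_card {V : Type*} [Fintype V] [DecidableEq V] {G : SimpleGraph V}
    [DecidableRel G.Adj] {τ : V → ℕ} {D : Finset V} (h : IsDynamo G τ D) : dyn G τ ≤ #D :=
  Nat.sInf_le ⟨D, h, rfl⟩

/-- Of two adjacent vertices whose thresholds equal their degrees, neither can be activated before
the other, so every dynamic monopoly contains one of them. -/
theorem IsDynamo.mem_or_mem_of_adj {V : Type*} [Fintype V] [DecidableEq V] {G : SimpleGraph V}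
    [DecidableRel G.Adj] {τ : V → ℕ} {D : Finset V} (h : IsDynamo G τ D) {u v : V}
    (huv : G.Adj u v) (hu : τ u = G.degree u) (hv : τ v = G.degree v) : u ∈ D ∨ v ∈ D := by
  obtain ⟨k, P, rfl, hex, hP⟩ := h
  by_contra! hD
  have key : ∀ a b i j, G.Adj a b → τ a = G.degree a → i ≤ k → a ∈ P i → a ∉ P 0 → j ≤ k →
      b ∈ P j → j < i := by
    intro a b i j hab ha hik hai ha0 hjk hbj
    have hi : 1 ≤ i := Nat.one_le_iff_ne_zero.2 fun h0 => ha0 (h0 ▸ hai)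
    have hle := ((hP i hi hik a).1 hai).2
    rw [ha, ← G.card_neighborFinset_eq_degree] at hle
    have heq := Finset.eq_of_subset_of_card_le (filter_subset _ _) hle
    have hb : b ∈ G.neighborFinset a := by simpa using hab
    rw [← heq, mem_filter] at hb
    obtain ⟨j', hj', hbj'⟩ := hb.2
    have := (hex b).unique ⟨hjk, hbj⟩ ⟨by omega, hbj'⟩
    omega
  obtain ⟨i, ⟨hi, hui⟩, -⟩ := hex u
  obtain ⟨j, ⟨hj, hvj⟩, -⟩ := hex v
  have h1 := key u v i j huv hu hi hui hD.1 hj hvj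
  have h2 := key v u j i huv.symm hv hj hvj hD.2 hi hui
  omega

/-- In a bipartite graph, a matching `M` needs exactly `|M|` initially active vertices: one
endpoint of each edge is necessary, and the endpoints in one colour class suffice. -/
theorem dyn_matchingAssignment {V : Type*} [Fintype V] [DecidableEq V] {G : SimpleGraph V}
    [DecidableRel G.Adj] (hG : G.Colorable 2) {M : G.Subgraph} (hM : M.IsMatching) :
    dyn G (matchingAssignment G M) = M.edgeSet.ncard := by
  classical
  have hτ : ∀ v ∈ M.verts, matchingAssignment G M v = G.degree v := fun v hv => by
    rw [← hM.support_eq_verts] at hv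
    simp [matchingAssignment, hv]
  apply le_antisymm
  · obtain ⟨c⟩ := hG
    let D : Finset V := {v | v ∈ M.verts ∧ c v = 0}
    have hD : IsDynamo G (matchingAssignment G M) D := by
      refine isDynamo_of_forall_closed fun S hDS hS => ?_
      have h0 : ∀ v, v ∉ M.verts ∨ c v = 0 → v ∈ S := by
        intro v hv
        by_cases hvM : v ∈ M.verts
        · exact hDS (by simpa [D, hvM] using hv)
        · refine hS v ?_
          rw [← hM.support_eq_verts] at hvM
          simp [matchingAssignment, hvM]
      refine eq_univ_iff_forall.2 fun v => ?_
      by_cases hv : v ∉ M.verts ∨ c v = 0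
      · exact h0 v hv
      push Not at hv
      refine hS v ?_
      rw [hτ v hv.1, ← G.card_neighborFinset_eq_degree]
      refine card_le_card fun w hw => ?_
      refine mem_filter.2 ⟨hw, h0 w (Or.inr ?_)⟩
      have := c.valid ((G.mem_neighborFinset v w).1 hw)
      omega
    refine (dyn_le_card hD).trans ?_
    rw [← Set.ncard_coe_finset]
    refine Set.ncard_le_ncard_of_injOn
      (fun v => if hv : v ∈ M.verts then (hM.toEdge ⟨v, hv⟩ : Sym2 V) else s(v, v))
      ?_ ?_ (Set.toFinite _)
    · intro v hv
      have hv : v ∈ M.verts := (mem_filter.1 hv).2.1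
      simp [hv]
    · intro v hv w hw hvw
      obtain ⟨hv, hcv⟩ := (mem_filter.1 hv).2
      obtain ⟨hw, hcw⟩ := (mem_filter.1 hw).2
      simp only [hv, hw, dif_pos] at hvw
      have h1 := hM.mem_coe_toEdge hv
      have h2 := hM.mem_coe_toEdge hw
      rw [← hvw] at h2
      by_contra hne
      have h3 := (Sym2.mem_and_mem_iff hne).1 ⟨h1, h2⟩
      have h4 : s(v, w) ∈ M.edgeSet := h3 ▸ (hM.toEdge ⟨v, hv⟩).2
      exact c.valid (M.adj_sub h4) (hcv.trans hcw.symm)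
  · obtain ⟨D, hD, hcard⟩ := exists_isDynamo_card_eq_dyn G (matchingAssignment G M)
    rw [← hcard, ← Set.ncard_coe_finset]
    refine (Set.ncard_le_ncard (t := (fun v => if hv : v ∈ M.verts then
      (hM.toEdge ⟨v, hv⟩ : Sym2 V) else s(v, v)) '' (D : Set V)) ?_ (Set.toFinite _)).trans
      (Set.ncard_image_le D.finite_toSet)
    intro e he
    induction e with | _ u v
    have he : M.Adj u v := he
    rcases hD.mem_or_mem_of_adj (M.adj_sub he) (hτ u he.fst_mem) (hτ v he.snd_mem) with h | h
    · exact ⟨u, h, by simp [he.fst_mem, hM.toEdge_eq_of_adj he]⟩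
    · exact ⟨v, h, by simp [he.snd_mem, hM.toEdge_eq_of_adj he.symm, Sym2.eq_swap]⟩

end DynamicMonopoly

/-! ### Rooting a forest -/

/-- A forest can be rooted: there is a rank, increasing towards the roots, that separates adjacent
vertices and for which each vertex has at most one neighbour of higher rank, its parent. -/
theorem SimpleGraph.IsAcyclic.exists_rank {V : Type*} [Finite V] {F : SimpleGraph V}
    (hF : F.IsAcyclic) : ∃ r : V → ℕ, (∀ u v, F.Adj u v → r u ≠ r v) ∧
      ∀ u v w, F.Adj u v → F.Adj u w → r u < r v → r u < r w → v = w := by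
  let root : V → V := fun v => (F.connectedComponentMk v).out
  have hroot (v : V) : F.Reachable (root v) v :=
    SimpleGraph.ConnectedComponent.exact (F.connectedComponentMk v).out_eq
  have hadj {u v : V} (h : F.Adj u v) : root u = root v := by
    simp only [root, SimpleGraph.ConnectedComponent.sound h.reachable]
  let d : V → ℕ := fun v => F.dist (root v) v
  obtain ⟨N, hN⟩ := (Set.finite_range d).bddAbove
  have hdN (v : V) : d v ≤ N := hN ⟨v, rfl⟩
  have hne {u v : V} (h : F.Adj u v) : d u = d v + 1 ∨ d v = d u + 1 := by
    have := hF.dist_eq_dist_add_one_of_adj_of_reachable (root u) h (hroot u)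
    simpa only [d, ← hadj h] using this
  refine ⟨fun v => N - d v, fun u v h => ?_, fun u v w huv huw hv hw => ?_⟩
  · have := hne h
    have := hdN u
    have := hdN v
    dsimp only
    omega
  -- Shortest walks from the root through `v` and through `w` to `u` are both paths.
  have path {x : V} (hux : F.Adj u x) (hx : N - d u < N - d x) :
      ∃ p : F.Walk (root u) x, (p.concat hux.symm).IsPath := by
    have hux' := hne hux
    have hr := hadj hux
    have h1 : d x = F.dist (root u) x := by simp only [d, hr]
    obtain ⟨p, hp⟩ := (hr ▸ hroot x : F.Reachable (root u) x).exists_walk_length_eq_dist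
    refine ⟨p, SimpleGraph.Walk.isPath_of_length_eq_dist _ ?_⟩
    rw [SimpleGraph.Walk.length_concat, hp, ← h1]
    change _ = d u
    omega
  obtain ⟨p, hp⟩ := path huv hv
  obtain ⟨q, hq⟩ := path huw hw
  have heq := congrArg Subtype.val ((hF.subsingleton_path _ _).elim ⟨_, hp⟩ ⟨_, hq⟩)
  simpa using congrArg SimpleGraph.Walk.penultimate heq

/-! ### The greedy dynamic monopoly of a forest and its matching -/

namespace DynamicMonopoly

/-- For a forest rooted by the rank `r`, processed from the leaves to the roots: a vertex awaits
its parent if it has one and if exactly `τ v - 1` of its children do not await `v`, so that the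
activation of its parent is just what it lacks. The children are the neighbours of smaller
rank; membership among them is bound by `∃ _` so that it is available for termination. -/
def AwaitsParent {V : Type*} (F : SimpleGraph V) (r τ : V → ℕ) (v : V) : Prop :=
  (∃ w, F.Adj v w ∧ r v < r w) ∧
    {u | ∃ _ : F.Adj v u ∧ r u < r v, ¬ AwaitsParent F r τ u}.ncard + 1 = τ v
termination_by r v

open Classical in
/-- Every threshold assignment on a forest is dominated by a matching: the initially active
vertices of the greedy dynamic monopoly can be matched to children, at total degree at most
the total threshold. -/
theorem exists_isMatching_dyn_le {V : Type*} [Fintype V] [DecidableEq V]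
    {F : SimpleGraph V} [DecidableRel F.Adj] (hF : F.IsAcyclic) {τ : V → ℕ}
    (hτ : ∀ v, τ v ≤ F.degree v) :
    ∃ M : F.Subgraph, M.IsMatching ∧ ∑ v, matchingAssignment F M v ≤ ∑ v, τ v ∧
      dyn F τ ≤ M.edgeSet.ncard := by
  obtain ⟨r, hne, huniq⟩ := hF.exists_rank
  let B : V → Prop := AwaitsParent F r τ
  -- The neighbours of `v` are its parent, its children awaiting `v`, and its other children.
  let par : V → Finset V := fun v => {w | F.Adj v w ∧ r v < r w}
  let chB : V → Finset V := fun v => {u | F.Adj v u ∧ r u < r v ∧ B u}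
  let chN : V → Finset V := fun v => {u | F.Adj v u ∧ r u < r v ∧ ¬ B u}
  have hpar (v : V) : #(par v) ≤ 1 := card_le_one.2 fun a ha b hb => by
    simp only [par, mem_filter, mem_univ, true_and] at ha hb
    exact huniq v a b ha.1 hb.1 ha.2 hb.2
  have hdeg (v : V) : F.degree v = #(chN v) + #(chB v) + #(par v) := by
    rw [← F.card_neighborFinset_eq_degree, ← card_union_of_disjoint, ← card_union_of_disjoint]
    · congr 1
      ext u
      have := hne v u
      simp only [SimpleGraph.mem_neighborFinset, chN, chB, par, mem_union, mem_filter, mem_univ,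
        true_and]
      grind
    · refine disjoint_left.2 fun u => ?_
      simp only [chN, chB, par, mem_union, mem_filter, mem_univ, true_and]
      grind
    · refine disjoint_left.2 fun u => ?_
      simp only [chN, chB, mem_filter, mem_univ, true_and]
      tauto
  have hB (v : V) : B v ↔ (∃ w, F.Adj v w ∧ r v < r w) ∧ #(chN v) + 1 = τ v := by
    have h1 : {u | ∃ _ : F.Adj v u ∧ r u < r v, ¬ AwaitsParent F r τ u} = (chN v : Set V) := by
      ext u
      simp only [chN, B, Set.mem_ofPred_eq, coe_filter, mem_univ, true_and, exists_prop, and_assoc]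
    simp only [B]
    rw [AwaitsParent, h1, Set.ncard_coe_finset]
  have hBpar {v : V} (h : B v) : #(par v) = 1 := by
    obtain ⟨⟨w, hw⟩, -⟩ := (hB v).1 h
    exact le_antisymm (hpar v) (card_pos.2 ⟨w, by simpa [par] using hw⟩)
  let D : Finset V := {v | ¬ B v ∧ #(chN v) < τ v}
  have hDB {v : V} (h : v ∈ D) : ¬ B v := (mem_filter.1 h).2.1
  have hDτ {v : V} (h : v ∈ D) : #(chN v) + #(par v) + 1 ≤ τ v := by
    obtain ⟨h1, h2⟩ := (mem_filter.1 h).2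
    rcases (par v).eq_empty_or_nonempty with hp | ⟨w, hw⟩
    · rw [hp, card_empty]; omega
    · have h3 : #(chN v) + 1 ≠ τ v := fun h3 =>
        h1 ((hB v).2 ⟨⟨w, by simpa [par] using hw⟩, h3⟩)
      have := hpar v
      omega
  have hdyn : IsDynamo F τ D := by
    refine isDynamo_of_forall_closed fun S hDS hS => ?_
    -- The vertices not awaiting their parents become active from the leaves to the roots.
    have hup : ∀ n v, r v = n → ¬ B v → v ∈ S := by
      intro n
      induction n using Nat.strong_induction_on with
      | _ n ih =>
        rintro v rfl hv
        by_cases hvD : #(chN v) < τ v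
        · exact hDS (mem_filter.2 ⟨mem_univ _, hv, hvD⟩)
        refine hS v ((not_lt.1 hvD).trans (card_le_card fun u hu => ?_))
        simp only [chN, mem_filter, mem_univ, true_and] at hu
        exact mem_filter.2 ⟨by simpa using hu.1, ih _ hu.2.1 u rfl hu.2.2⟩
    -- The remaining ones then become active from the roots to the leaves.
    obtain ⟨N, hN⟩ := (Set.finite_range r).bddAbove
    have hdown : ∀ n v, N - r v = n → v ∈ S := by
      intro n
      induction n using Nat.strong_induction_on with
      | _ n ih =>
        rintro v rfl
        by_cases hv : B v
        · obtain ⟨⟨w, hw, hvw⟩, hcard⟩ := (hB v).1 hv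
          have hwN : r w ≤ N := hN ⟨w, rfl⟩
          refine hS v ?_
          have hwn : w ∉ chN v := by
            simp only [chN, mem_filter, mem_univ, true_and]
            omega
          rw [← hcard, ← card_insert_of_notMem hwn]
          refine card_le_card fun u hu => ?_
          rcases mem_insert.1 hu with rfl | hu
          · exact mem_filter.2 ⟨by simpa using hw, ih _ (by omega) u rfl⟩
          · simp only [chN, mem_filter, mem_univ, true_and] at hu
            exact mem_filter.2 ⟨by simpa using hu.1, hup _ u rfl hu.2.2⟩
        · exact hup _ v rfl hv
    exact eq_univ_iff_forall.2 fun v => hdown _ v rfl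
  have hex (v : V) : ∃ u, v ∈ D → u ∈ chB v := by
    by_cases hv : v ∈ D
    · have h1 := hDτ hv
      have h2 := hτ v
      have h3 := hdeg v
      obtain ⟨u, hu⟩ := card_pos.1 (show 0 < #(chB v) by omega)
      exact ⟨u, fun _ => hu⟩
    · exact ⟨v, fun h => absurd h hv⟩
  choose f hf using hex
  have hchB {u v : V} : u ∈ chB v ↔ F.Adj v u ∧ r u < r v ∧ B u := by simp [chB]
  have hchB_inj {u v w : V} (hv : u ∈ chB v) (hw : u ∈ chB w) : v = w := by
    rw [hchB] at hv hw
    exact huniq u v w hv.1.symm hw.1.symm hv.2.1 hw.2.1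
  have hfB {v : V} (hv : v ∈ D) : B (f v) := (hchB.1 (hf v hv)).2.2
  have hfinj : Set.InjOn f D := fun v hv w hw hvw =>
    hchB_inj (hf v hv) (hvw ▸ hf w hw)
  have hfD {v : V} (hv : v ∈ D) : f v ∉ D := fun h => hDB h (hfB hv)
  let M : F.Subgraph :=
    { verts := {a | a ∈ D ∨ ∃ v ∈ D, a = f v}
      Adj := fun a b => (a ∈ D ∧ b = f a) ∨ (b ∈ D ∧ a = f b)
      adj_sub := by
        rintro a b (⟨h, rfl⟩ | ⟨h, rfl⟩)
        · exact (hchB.1 (hf a h)).1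
        · exact (hchB.1 (hf b h)).1.symm
      edge_vert := by
        rintro a b (⟨h, rfl⟩ | ⟨h, rfl⟩)
        · exact Or.inl h
        · exact Or.inr ⟨b, h, rfl⟩
      symm := ⟨fun a b => Or.symm⟩ }
  have hM : M.IsMatching := by
    rintro a (ha | ⟨v, hv, rfl⟩)
    · refine ⟨f a, Or.inl ⟨ha, rfl⟩, ?_⟩
      rintro b (⟨-, h⟩ | ⟨hb, h⟩)
      · exact h
      · exact absurd (h ▸ ha) (hfD hb)
    · refine ⟨v, Or.inr ⟨hv, rfl⟩, ?_⟩
      rintro b (⟨h, -⟩ | ⟨hb, h⟩)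
      · exact absurd h (hfD hv)
      · exact hfinj hb hv h.symm
  refine ⟨M, hM, ?_, ?_⟩
  · let X : Finset V := D ∪ D.image f
    have hdisj : Disjoint D (D.image f) := disjoint_left.2 fun a ha h => by
      obtain ⟨v, hv, rfl⟩ := mem_image.1 h
      exact hfD hv ha
    let T : Finset V := X.biUnion chB
    have hTB {u : V} (hu : u ∈ T) : B u := by
      obtain ⟨v, -, hv⟩ := mem_biUnion.1 hu
      exact (hchB.1 hv).2.2
    have hT : #T = ∑ v ∈ X, #(chB v) := card_biUnion fun v _ w _ hvw =>
      disjoint_left.2 fun u hu hu' => hvw (hchB_inj hu hu')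
    have hfT : D.image f ⊆ T := fun u hu => by
      obtain ⟨v, hv, rfl⟩ := mem_image.1 hu
      exact mem_biUnion.2 ⟨v, mem_union_left _ hv, hf v hv⟩
    have hcardf : #(D.image f) = #D := card_image_of_injOn hfinj
    have hXT : Disjoint X (T \ D.image f) := disjoint_left.2 fun u hu hu' => by
      rw [mem_sdiff] at hu'
      rcases mem_union.1 hu with h | h
      · exact hDB h (hTB hu'.1)
      · exact hu'.2 h
    have hsum1 : ∑ v, matchingAssignment F M v = ∑ v ∈ X, F.degree v := by
      rw [← sum_filter_add_sum_filter_not univ (· ∈ X)]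
      rw [sum_congr rfl (g := fun v => F.degree v), sum_eq_zero (s := filter (· ∉ X) univ)]
      · simp
      · intro v hv
        have : v ∉ M.support := by
          rw [hM.support_eq_verts]
          simpa [X, M, eq_comm] using hv
        simp [matchingAssignment, this]
      · intro v hv
        have : v ∈ M.support := by
          rw [hM.support_eq_verts]
          simpa [X, M, eq_comm] using hv
        simp [matchingAssignment, this]
    have hsum2 : ∑ v ∈ X, F.degree v + #D ≤ ∑ v ∈ X, τ v + #T := by
      rw [hT, ← sum_add_distrib, sum_union hdisj, sum_union hdisj]
      have h1 : ∑ v ∈ D, F.degree v + #D ≤ ∑ v ∈ D, (τ v + #(chB v)) := by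
        rw [card_eq_sum_ones, ← sum_add_distrib]
        refine sum_le_sum fun v hv => ?_
        have := hDτ hv
        have := hdeg v
        omega
      have h2 : ∑ v ∈ D.image f, F.degree v ≤ ∑ v ∈ D.image f, (τ v + #(chB v)) := by
        refine sum_le_sum fun u hu => ?_
        have hu := hTB (hfT hu)
        have := hBpar hu
        have := ((hB u).1 hu).2
        have := hdeg u
        omega
      omega
    -- Each vertex of `T` left unmatched has threshold at least one, which pays for the excess.
    have hsum3 : #T ≤ #D + ∑ v ∈ T \ D.image f, τ v := by
      rw [← hcardf, ← card_sdiff_add_card_eq_card hfT, add_comm]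
      refine Nat.add_le_add_left ?_ _
      rw [card_eq_sum_ones]
      refine sum_le_sum fun u hu => ?_
      have := ((hB u).1 (hTB (mem_sdiff.1 hu).1)).2
      omega
    have hsum4 : ∑ v ∈ X, τ v + ∑ v ∈ T \ D.image f, τ v ≤ ∑ v, τ v := by
      rw [← sum_union hXT]
      exact sum_le_sum_of_subset (subset_univ _)
    omega
  · refine (dyn_le_card hdyn).trans ?_
    rw [← Set.ncard_coe_finset]
    refine Set.ncard_le_ncard_of_injOn (fun v => s(v, f v)) ?_ ?_ (Set.toFinite _)
    · intro v hv
      exact Or.inl ⟨hv, rfl⟩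
    · intro v hv w hw hvw
      rcases Sym2.eq_iff.1 hvw with ⟨h, -⟩ | ⟨h, -⟩
      · exact h
      · exact absurd (h ▸ hv) (hfD hw)

end DynamicMonopoly

theorem proposition3p5 {V : Type*} [Fintype V] [DecidableEq V]
    (F : SimpleGraph V) [DecidableRel F.Adj] (hF : F.IsAcyclic) (t : ℝ) (ht : 0 < t) :
    ∃ M : F.Subgraph, M.IsMatching ∧
      DynamicMonopoly.average (DynamicMonopoly.matchingAssignment F M) ≤ t ∧
      DynamicMonopoly.ldyn F t =
        DynamicMonopoly.dyn F (DynamicMonopoly.matchingAssignment F M) ∧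
      DynamicMonopoly.dyn F (DynamicMonopoly.matchingAssignment F M) = M.edgeSet.ncard := by
  have hgreat := DynamicMonopoly.isGreatest_ldyn F ht.le
  obtain ⟨τ, hτ, hτt, hdyn⟩ := hgreat.1
  obtain ⟨M, hM, hsum, hle⟩ := DynamicMonopoly.exists_isMatching_dyn_le hF hτ
  have hMdyn := DynamicMonopoly.dyn_matchingAssignment hF.colorable_two hM
  have hMt : DynamicMonopoly.average (DynamicMonopoly.matchingAssignment F M) ≤ t := by
    refine le_trans ?_ hτt
    unfold DynamicMonopoly.average
    exact div_le_div_of_nonneg_right (by exact_mod_cast hsum) (Nat.cast_nonneg _)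
  refine ⟨M, hM, hMt, le_antisymm ?_ (hgreat.2 ⟨_, fun v => ?_, hMt, rfl⟩), hMdyn⟩
  · rw [← hdyn, hMdyn]
    exact hle
  · unfold DynamicMonopoly.matchingAssignment
    split_ifs <;> simp
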